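/- Let $\mathbb B$ be a complete Boolean algebra. For a sequence $x=\langle x_n:n\in\omega\rangle$ in $\mathbb B$ put $\limsup x=\bigwedge_{k}\bigvee_{n\ge k}x_n$ and $\liminf x=\bigvee_{k}\bigwedge_{n\ge k}x_n$. A convergence on a set $X$ is a map $\lambda:X^\omega\to P(X)$; it is called topological if there is a topology on $X$ such that, for every sequence $x\in X^\omega$, $\lambda(x)$ is exactly the set of all limit points of $x$ in that topology, that is, of all $a\in X$ each of whose neighbourhoods contains all but finitely many members of $x$. Let $\lambda_{\mathrm{ls}}$ and $\lambda_{\mathrm{li}}$ be the convergences on $\mathbb B$ defined by $$\lambda_{\mathrm{ls}}(x)=\{b\in\mathbb B:\limsup x\le b\},\qquad \lambda_{\mathrm{li}}(x)=\{b\in\mathbb B: b\le\liminf x\}.$$ Then the following conditions are equivalent: (a) $\lambda_{\mathrm{ls}}$ is a topological convergence; (b) $\lambda_{\mathrm{li}}$ is a topological convergence; (c) $\mathbb B$ is $(\omega,2)$-distributive, that is, $\bigwedge_{n\in\omega}\bigvee_{i<2}a_{n,i}=\bigvee_{f:\omega\to 2}\bigwedge_{n\in\omega}a_{n,f(n)}$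 for every family $\langle a_{n,i}:n\in\omega,\ i<2\rangle$ in $\mathbb B$; (d) forcing by $\mathbb B$ does not produce new reals, that is, in the Boolean-valued universe $V^{\mathbb B}$ the statement "every subset of $\omega$ belongs to the ground model $V$" has Boolean value $1$. -/

import Mathlib

universe u

/-- A convergence on `X`: a map assigning to each sequence in `X` its set of limits. -/
abbrev Convergence (X : Type u) : Type u := (ℕ → X) → Set X

/-- The convergence determined by a topology: `a` is a limit of `x` when every neighbourhood of `a`
contains all but finitely many members of `x`. -/
def topologyLim {X : Type u} (t : TopologicalSpace X) : Convergence X :=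
  fun x => {a | Filter.Tendsto x Filter.atTop (@nhds X t a)}

/-- A convergence is topological when it is the convergence determined by some topology. -/
def Convergence.IsTopological {X : Type u} (c : Convergence X) : Prop :=
  ∃ t : TopologicalSpace X, c = topologyLim t

/-- The convergence `x ↦ (limsup x)↑`. -/
def convLs (B : Type u) [CompleteBooleanAlgebra B] : Convergence B :=
  fun x => Set.Ici (Filter.limsup x Filter.atTop)

/-- The convergence `x ↦ (liminf x)↓`. -/
def convLi (B : Type u) [CompleteBooleanAlgebra B] : Convergence B :=
  fun x => Set.Iic (Filter.liminf x Filter.atTop)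

/-- `(ω, 2)`-distributivity: `⋀ₙ ⋁ᵢ aₙᵢ = ⋁_{f : ω → 2} ⋀ₙ a_{n, f n}`. -/
def IsOmegaTwoDistributive (B : Type u) [CompleteBooleanAlgebra B] : Prop :=
  ∀ a : ℕ → Fin 2 → B, (⨅ n, ⨆ i, a n i) = ⨆ f : ℕ → Fin 2, ⨅ n, a n (f n)

/-- The class `V^B` of `B`-names: a name is a family of names, each with a value in `B`. -/
inductive BName (B : Type u) : Type (u + 1)
  | mk (ι : Type u) (elt : ι → BName B) (val : ι → B) : BName B

namespace BName

variable {B : Type u}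

/-- The canonical name of a set of the ground universe. -/
def check [Top B] : PSet.{u} → BName B
  | ⟨ι, A⟩ => ⟨ι, fun i => check (A i), fun _ => ⊤⟩

variable [CompleteBooleanAlgebra B]

/-- The Boolean value `‖x = y‖`, that is, of `(∀ s ∈ x, ∃ t ∈ y, s = t) ∧ (∀ t ∈ y, ∃ s ∈ x, s = t)`. -/
def eqVal : BName B → BName B → B
  | ⟨_, x, b⟩, ⟨_, y, c⟩ =>
    (⨅ i, b i ⇨ ⨆ j, c j ⊓ eqVal (x i) (y j)) ⊓ (⨅ j, c j ⇨ ⨆ i, b i ⊓ eqVal (x i) (y j))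

/-- The Boolean value `‖x ∈ y‖`. -/
def memVal (x : BName B) : BName B → B
  | ⟨_, y, c⟩ => ⨆ j, c j ⊓ eqVal x (y j)

/-- The Boolean value `‖x ⊆ y‖`. -/
def subsetVal : BName B → BName B → B
  | ⟨_, x, b⟩, y => ⨅ i, b i ⇨ memVal (x i) y

/-- The Boolean value `‖x ∈ V‖`, where `V` is the ground universe. -/
def groundVal (x : BName B) : B :=
  ⨆ y : PSet.{u}, eqVal x (check y)

end BName

/-- Forcing by `B` produces no new reals: in the Boolean-valued universe `V^B` it is true (has
value `⊤`) that every subset of `ω` belongs to the ground universe. -/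
def ForcingAddsNoNewReals (B : Type u) [CompleteBooleanAlgebra B] : Prop :=
  (⨅ x : BName B, BName.subsetVal x (BName.check PSet.omega) ⇨ BName.groundVal x) = ⊤

/-! Distributivity means that the branches `f : ℕ → Bool` of the tree of sign choices for any
sequence have join `⊤` (`isOmegaTwoDistributive_iff`). Below a branch every term is decided, which
makes the lower topology induce `convLs`. Conversely, topological convergence satisfies the
subsequence principle: if every subsequence has a further subsequence tending to `⊥`, so does the
sequence. When the branches miss some `b ≠ ⊥`, the tree nodes cut down to `b` violate this, by
compactness of Cantor space. Complementation exchanges the two convergences. For forcing, a name for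
a subset of `ω` amounts to its sequence of membership values, and a branch of their tree forces it
to equal a ground model set. -/

open Filter Topology

section Distributivity

variable {B : Type u} [CompleteBooleanAlgebra B]

/-- The element `a` or its complement, according to a truth value. -/
def signed (a : B) (t : Bool) : B := if t then a else aᶜ

theorem signed_true (a : B) : signed a true = a := rfl

theorem signed_false (a : B) : signed a false = aᶜ := rfl

theorem isOmegaTwoDistributive_iff :
    IsOmegaTwoDistributive B ↔
      ∀ a : ℕ → B, (⨆ f : ℕ → Bool, ⨅ n, signed (a n) (f n)) = ⊤ := by
  constructor
  · intro h a
    have h1 := h fun n i => signed (a n) (i = 0)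
    have h2 : (⨅ n, ⨆ i : Fin 2, signed (a n) (i = 0)) = ⊤ := by
      refine iInf_eq_top.2 fun n => top_unique ?_
      rw [← sup_compl_eq_top (x := a n)]
      exact sup_le (le_iSup_of_le 0 (by simp [signed])) (le_iSup_of_le 1 (by simp [signed]))
    rw [h2] at h1
    refine top_unique (h1.le.trans (iSup_le fun f => ?_))
    exact le_iSup (fun f : ℕ → Bool => ⨅ n, signed (a n) (f n)) fun n => decide (f n = 0)
  · intro h a
    refine le_antisymm ?_
      (iSup_le fun f => iInf_mono fun n => le_iSup (fun i => a n i) (f n))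
    rw [← inf_top_eq (⨅ n, ⨆ i, a n i), ← h fun n => a n 0, inf_iSup_eq]
    -- Where `a n 0` is accepted take index 0; where it is refused, the join over `i` leaves only
    -- index 1.
    refine iSup_le fun f => le_iSup_of_le (fun n => if f n then 0 else 1) (le_iInf fun n => ?_)
    refine (inf_le_inf (iInf_le _ n) (iInf_le _ n)).trans ?_
    cases hf : f n
    · have : (⨆ i, a n i) ≤ a n 0 ⊔ a n 1 := by
        refine iSup_le fun i => ?_
        fin_cases i
        exacts [le_sup_left, le_sup_right]
      refine (inf_le_inf_right _ this).trans ?_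
      simp [signed, hf, inf_sup_right]
    · simp [signed, hf]

/-- The complement gives a bijection between the two convergences. -/
theorem mem_convLi_iff (x : ℕ → B) (a : B) :
    a ∈ convLi B x ↔ aᶜ ∈ convLs B (compl ∘ x) := by
  simp only [convLi, convLs, Set.mem_Iic, Set.mem_Ici]
  rw [← compl_le_compl_iff_le, liminf_compl]

theorem convLs_isTopological_iff_convLi :
    (convLs B).IsTopological ↔ (convLi B).IsTopological := by
  have key (x : ℕ → B) (a : B) : a ∈ convLs B x ↔ aᶜ ∈ convLi B (compl ∘ x) := by
    have hx : compl ∘ compl ∘ x = x := funext fun n => compl_compl (x n)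
    rw [mem_convLi_iff, compl_compl, hx]
  constructor
  · rintro ⟨t, ht⟩
    refine ⟨t.induced compl, funext fun x => Set.ext fun a => ?_⟩
    rw [mem_convLi_iff, ht]
    simp only [topologyLim, Set.mem_ofPred_eq, nhds_induced, tendsto_comap_iff]
  · rintro ⟨t, ht⟩
    refine ⟨t.induced compl, funext fun x => Set.ext fun a => ?_⟩
    rw [key, ht]
    simp only [topologyLim, Set.mem_ofPred_eq, nhds_induced, tendsto_comap_iff]

/-- In a distributive algebra, `(limsup x)↑` is the set of limits of `x` in the lower topology. -/
theorem IsOmegaTwoDistributive.convLs_isTopological (h : IsOmegaTwoDistributive B) :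
    (convLs B).IsTopological := by
  rw [isOmegaTwoDistributive_iff] at h
  refine ⟨Topology.lower B, funext fun x => Set.ext fun a => ?_⟩
  have hlim : a ∈ topologyLim (Topology.lower B) x ↔ ∀ c, ¬ c ≤ a → ∀ᶠ n in atTop, ¬ c ≤ x n := by
    simp only [topologyLim, Set.mem_ofPred_eq]
    rw [TopologicalSpace.tendsto_nhds_generateFrom_iff]
    constructor
    · exact fun H c hc => H _ ⟨c, rfl⟩ hc
    · rintro H _ ⟨c, rfl⟩ hc
      exact H c hc
  rw [hlim]
  simp only [convLs, Set.mem_Ici]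
  constructor
  · intro ha c hc
    by_contra hn
    refine hc (le_trans ?_ ha)
    exact le_limsup_of_frequently_le (by simpa [Filter.Frequently] using hn)
  · intro H
    rw [← disjoint_compl_right_iff, disjoint_iff, ← inf_top_eq (limsup x atTop ⊓ aᶜ), ← h x,
      inf_iSup_eq, iSup_eq_bot]
    intro f
    by_contra hc
    -- Each `x n` is decided by `c`. Since `c` lies under `x n` only finitely often, it is
    -- eventually disjoint from `x n`, hence from the limit superior.
    set c := limsup x atTop ⊓ aᶜ ⊓ ⨅ n, signed (x n) (f n) with hcdef
    have hca : c ≤ aᶜ := inf_le_left.trans inf_le_right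
    have hcl : c ≤ limsup x atTop := inf_le_left.trans inf_le_left
    have hev := H c fun hle => hc (bot_unique ((le_inf hle hca).trans (inf_compl_self _).le))
    have hle : limsup x atTop ≤ cᶜ := by
      refine limsup_le_of_le (h := hev.mono fun n hn => ?_)
      have hs : c ≤ signed (x n) (f n) := inf_le_right.trans (iInf_le _ n)
      cases hf : f n
      · rw [hf, signed_false] at hs
        exact le_compl_comm.1 hs
      · rw [hf, signed_true] at hs
        exact absurd hs hn
    exact hc (bot_unique ((le_inf le_rfl (hcl.trans hle)).trans (inf_compl_self _).le))

/-- Finitely many sign choices always distribute: splitting a nonzero element by `a k` leaves a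
nonzero half. -/
theorem exists_inf_iInf_signed_ne_bot (a : ℕ → B) {c : B} (hc : c ≠ ⊥) (k : ℕ) :
    ∃ g : ℕ → Bool, c ⊓ ⨅ i < k, signed (a i) (g i) ≠ ⊥ := by
  induction k with
  | zero => exact ⟨fun _ => true, by simpa using hc⟩
  | succ k ih =>
    obtain ⟨g, hg⟩ := ih
    have : ∃ t, (c ⊓ ⨅ i < k, signed (a i) (g i)) ⊓ signed (a k) t ≠ ⊥ := by
      by_contra! H
      apply hg
      rw [← inf_top_eq (c ⊓ _), ← sup_compl_eq_top (x := a k), inf_sup_left]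
      exact sup_eq_bot_iff.2 ⟨H true, H false⟩
    obtain ⟨t, ht⟩ := this
    refine ⟨Function.update g k t, ?_⟩
    rw [Nat.iInf_lt_succ, ← inf_assoc, Function.update_self]
    convert ht using 6 with i hi
    rw [Function.update_of_ne (ne_of_lt hi)]

theorem exists_log_eq_and_testBit_eq (g : ℕ → Bool) (k : ℕ) :
    ∃ n, Nat.log 2 n = k ∧ ∀ i < k, n.testBit i = g i := by
  have hlt := Nat.ofBits_lt_two_pow fun i : Fin k => g i
  refine ⟨2 ^ k + Nat.ofBits fun i : Fin k => g i, ?_, fun i hi => ?_⟩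
  · rw [Nat.log_eq_iff (Or.inr ⟨one_lt_two, by positivity⟩), pow_succ]
    omega
  · rw [Nat.testBit_two_pow_add_gt hi, Nat.testBit_ofBits_lt _ _ hi]

theorem tendsto_natLog_two : Tendsto (Nat.log 2) atTop atTop :=
  tendsto_atTop.2 fun k =>
    (eventually_ge_atTop (2 ^ k)).mono fun _ hn => Nat.le_log_of_pow_le one_lt_two hn

/-- If `b` excludes every ground model branch of the tree of decisions about `a`, then the nodes of
that tree below `b` form a sequence each of whose subsequences has a subsequence with limit
superior `⊥`, while its own limit superior is `b`. -/
theorem isOmegaTwoDistributive_of_convLs_isTopological (h : (convLs B).IsTopological) :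
    IsOmegaTwoDistributive B := by
  obtain ⟨t, ht⟩ := h
  have hlim (x : ℕ → B) : limsup x atTop = ⊥ ↔ Tendsto x atTop (@nhds B t ⊥) := by
    have := Set.ext_iff.1 (congrFun ht x) ⊥
    simpa [convLs, topologyLim] using this
  refine isOmegaTwoDistributive_iff.2 fun a => ?_
  set b := (⨆ f : ℕ → Bool, ⨅ n, signed (a n) (f n))ᶜ with hb
  have hbf (f : ℕ → Bool) : b ⊓ ⨅ n, signed (a n) (f n) = ⊥ :=
    bot_unique <| (inf_le_inf_left b
      (le_iSup (fun f : ℕ → Bool => ⨅ n, signed (a n) (f n)) f)).trans (compl_inf_self _).le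
  -- The leading binary digit of `n` marks the level of a node and the lower digits give its signs,
  -- so every node is listed and levels tend to infinity.
  let x : ℕ → B := fun n => b ⊓ ⨅ i < Nat.log 2 n, signed (a i) (n.testBit i)
  have hx : limsup x atTop = ⊥ := by
    refine (hlim x).2 (tendsto_of_subseq_tendsto fun ns hns => ?_)
    -- By compactness, some subsequence of the nodes converges to a branch `f`, each sign being
    -- eventually that of `f`.
    obtain ⟨f, φ, hφ, hf⟩ := SeqCompactSpace.tendsto_subseq fun k i => (ns k).testBit i
    refine ⟨φ, (hlim _).1 (bot_unique ?_)⟩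
    rw [← hbf f]
    refine le_inf (limsup_le_of_le (h := .of_forall fun n => inf_le_left))
      (le_iInf fun i => limsup_le_of_le (h := ?_))
    have h1 : ∀ᶠ k in atTop, i < Nat.log 2 (ns (φ k)) :=
      (tendsto_natLog_two.comp (hns.comp hφ.tendsto_atTop)).eventually_gt_atTop i
    have h2 : ∀ᶠ k in atTop, (ns (φ k)).testBit i = f i := by
      have := tendsto_pi_nhds.1 hf i
      rw [nhds_discrete, tendsto_pure] at this
      exact this
    filter_upwards [h1, h2] with k hk1 hk2
    rw [← hk2]
    exact inf_le_right.trans (iInf₂_le i hk1)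
  have hbx : b ≤ limsup x atTop := by
    rw [limsup_eq_iInf_iSup_of_nat]
    refine le_iInf fun k => ?_
    rw [← disjoint_compl_right_iff, disjoint_iff]
    -- The part of `b` outside the tail is compatible with a node of level `k`; its index is at
    -- least `k`, so that node is in the tail.
    by_contra hc
    obtain ⟨g, hg⟩ := exists_inf_iInf_signed_ne_bot a hc k
    obtain ⟨n, hn, hng⟩ := exists_log_eq_and_testBit_eq g k
    have hkn : k ≤ n := hn ▸ Nat.log_le_self 2 n
    have hxn : (b ⊓ ⨅ i < k, signed (a i) (g i)) = x n := by
      simp only [x, hn]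
      congr! 5 with i hi
      exact (hng i hi).symm
    apply hg
    rw [inf_right_comm, hxn, ← disjoint_iff, disjoint_compl_right_iff]
    exact le_iSup₂_of_le n hkn le_rfl
  rw [hx, le_bot_iff, hb, compl_eq_bot] at hbx
  exact hbx

end Distributivity

/-! ### Boolean values of subsets of `ω` -/

theorem PSet.rank_ofNat (n : ℕ) : (PSet.ofNat.{u} n).rank = n := by
  induction n with
  | zero => exact PSet.rank_empty
  | succ n ih =>
    rw [PSet.ofNat, PSet.rank_insert, ih]
    simp

theorem PSet.ofNat_equiv_ofNat {m n : ℕ} (h : (PSet.ofNat.{u} m).Equiv (PSet.ofNat.{u} n)) :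
    m = n := by
  have := PSet.rank_congr h
  simpa [PSet.rank_ofNat] using this

namespace BName

variable {B : Type u} [CompleteBooleanAlgebra B]

theorem eqVal_symm (x y : BName B) : eqVal x y = eqVal y x := by
  induction x generalizing y with
  | mk ι x b ih =>
    obtain ⟨κ, y, c⟩ := y
    simp only [eqVal, ih]
    exact inf_comm _ _

theorem eqVal_check_of_equiv {p q : PSet.{u}} (h : p.Equiv q) :
    eqVal (check p : BName B) (check q) = ⊤ := by
  induction p generalizing q with
  | mk α A ih =>
    obtain ⟨β, C⟩ := q
    simp only [check, eqVal, top_himp, top_inf_eq]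
    refine inf_eq_top_iff.2 ⟨iInf_eq_top.2 fun i => ?_, iInf_eq_top.2 fun j => ?_⟩
    · obtain ⟨j, hj⟩ := h.1 i
      exact top_unique (le_iSup_of_le j (ih i hj).ge)
    · obtain ⟨i, hi⟩ := h.2 j
      exact top_unique (le_iSup_of_le i (ih i hi).ge)

theorem eqVal_check_of_not_equiv {p q : PSet.{u}} (h : ¬ p.Equiv q) :
    eqVal (check p : BName B) (check q) = ⊥ := by
  induction p generalizing q with
  | mk α A ih =>
    obtain ⟨β, C⟩ := q
    simp only [check, eqVal, top_himp, top_inf_eq]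
    rw [PSet.equiv_iff, not_and_or] at h
    push Not at h
    rcases h with ⟨i, hi⟩ | ⟨j, hj⟩
    · refine bot_unique (inf_le_left.trans ((iInf_le _ i).trans (iSup_le fun j => ?_)))
      exact (ih i (hi j)).le
    · refine bot_unique (inf_le_right.trans ((iInf_le _ j).trans (iSup_le fun i => ?_)))
      exact (ih i (hj i)).le

/-- The name of the subset of `ω` that contains `n` with value `a n`. -/
def ofSeq (a : ℕ → B) : BName B :=
  ⟨ULift.{u} ℕ, fun n => check (PSet.ofNat n.down), fun n => a n.down⟩

theorem subsetVal_ofSeq (a : ℕ → B) : subsetVal (ofSeq a) (check PSet.omega) = ⊤ := by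
  refine iInf_eq_top.2 fun n => ?_
  rw [himp_eq_top_iff]
  refine le_top.trans (le_iSup_of_le n ?_)
  rw [top_inf_eq]
  exact (eqVal_check_of_equiv (PSet.Equiv.refl _)).ge

open Classical in
-- Distinct numerals have equality value `⊥`, so `n` enters `ofSeq a` with value exactly `a n`,
-- while membership in `check y` is already decided.
theorem eqVal_ofSeq_check_le (a : ℕ → B) (y : PSet.{u}) (n : ℕ) :
    eqVal (ofSeq a) (check y) ≤ signed (a n) (decide (PSet.ofNat n ∈ y)) := by
  obtain ⟨β, C⟩ := y
  simp only [ofSeq, check, eqVal, top_himp, top_inf_eq]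
  by_cases h : PSet.ofNat n ∈ PSet.mk β C
  · rw [decide_eq_true h, signed_true]
    obtain ⟨j, hj⟩ := h
    refine inf_le_right.trans ((iInf_le _ j).trans (iSup_le fun i => ?_))
    by_cases hi : (PSet.ofNat i.down).Equiv (C j)
    · rw [← PSet.ofNat_equiv_ofNat (hi.trans hj.symm)]
      exact inf_le_left
    · rw [eqVal_check_of_not_equiv hi, inf_bot_eq]
      exact bot_le
  · rw [decide_eq_false h, signed_false]
    refine inf_le_left.trans ((iInf_le _ (ULift.up n)).trans ?_)
    have hbot : (⨆ j, eqVal (check (PSet.ofNat n) : BName B) (check (C j))) = ⊥ :=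
      iSup_eq_bot.2 fun j => eqVal_check_of_not_equiv fun hj => h ⟨j, hj⟩
    rw [hbot, himp_bot]

/-- The subset of `ω` with a given characteristic function. -/
def groundSubset (f : ℕ → Bool) : PSet.{u} :=
  ⟨ULift.{u} {n // f n = true}, fun n => PSet.ofNat n.down.1⟩

theorem inf_le_eqVal_check_groundSubset (x : BName B) (f : ℕ → Bool) :
    (subsetVal x (check PSet.omega) ⊓ ⨅ n, signed (memVal (check (PSet.ofNat n)) x) (f n)) ≤
      eqVal x (check (groundSubset f)) := by
  obtain ⟨ι, x, b⟩ := x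
  simp only [groundSubset, check, eqVal, top_himp, top_inf_eq]
  refine le_inf (le_iInf fun i => ?_) (le_iInf fun n => ?_)
  · rw [le_himp_iff, inf_right_comm]
    -- A member of `x` is some numeral `n`; if `f n` is false, the sign at `n` contradicts this
    -- membership.
    have h1 : subsetVal (mk ι x b) (check PSet.omega) ⊓ b i ≤
        ⨆ n : ULift.{u} ℕ, b i ⊓ eqVal (x i) (check (PSet.ofNat n.down)) := by
      rw [← inf_iSup_eq]
      refine le_inf inf_le_right ?_
      rw [← le_himp_iff]
      refine (iInf_le _ i).trans (himp_le_himp_left ?_)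
      exact iSup_mono fun n => inf_le_right
    refine (inf_le_inf_right _ h1).trans ?_
    rw [iSup_inf_eq]
    refine iSup_le fun n => ?_
    cases hf : f n.down
    · have h2 : b i ⊓ eqVal (x i) (check (PSet.ofNat n.down)) ≤
          memVal (check (PSet.ofNat n.down)) (mk ι x b) := by
        rw [eqVal_symm]
        exact le_iSup (fun i => b i ⊓ eqVal (check (PSet.ofNat n.down)) (x i)) i
      refine (inf_le_inf h2 (iInf_le _ n.down)).trans ?_
      rw [hf, signed_false, inf_compl_self]
      exact bot_le
    · exact inf_le_left.trans (inf_le_right.trans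
        (le_iSup (fun n : ULift.{u} {n // f n = true} =>
          eqVal (x i) (check (PSet.ofNat n.down.1))) ⟨n.down, hf⟩))
  · refine inf_le_right.trans ((iInf_le _ n.down.1).trans ?_)
    rw [n.down.2, signed_true]
    exact iSup_mono fun i => by rw [eqVal_symm]

end BName

theorem isOmegaTwoDistributive_iff_forcingAddsNoNewReals {B : Type u} [CompleteBooleanAlgebra B] :
    IsOmegaTwoDistributive B ↔ ForcingAddsNoNewReals B := by
  rw [isOmegaTwoDistributive_iff]
  constructor
  · intro h
    refine iInf_eq_top.2 fun x => ?_
    rw [himp_eq_top_iff, ← inf_top_eq (BName.subsetVal _ _),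
      ← h fun n => BName.memVal (BName.check (PSet.ofNat n)) x, inf_iSup_eq]
    exact iSup_le fun f => (BName.inf_le_eqVal_check_groundSubset x f).trans
      (le_iSup (fun y => BName.eqVal x (BName.check y)) (BName.groundSubset f))
  · intro h a
    have h1 := iInf_eq_top.1 h (BName.ofSeq a)
    rw [BName.subsetVal_ofSeq, top_himp] at h1
    classical
    refine top_unique (h1.ge.trans (iSup_le fun y => ?_))
    -- The trace of `y` on `ω` is the branch.
    exact le_iSup_of_le (fun n => decide (PSet.ofNat n ∈ y))
      (le_iInf fun n => BName.eqVal_ofSeq_check_le a y n)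

theorem mainTheorem1 (B : Type u) [CompleteBooleanAlgebra B] :
    List.TFAE
      [ (convLs B).IsTopological,
        (convLi B).IsTopological,
        IsOmegaTwoDistributive B,
        ForcingAddsNoNewReals B ] := by
  tfae_have 1 ↔ 2 := convLs_isTopological_iff_convLi
  tfae_have 1 → 3 := isOmegaTwoDistributive_of_convLs_isTopological
  tfae_have 3 → 1 := IsOmegaTwoDistributive.convLs_isTopological
  tfae_have 3 ↔ 4 := isOmegaTwoDistributive_iff_forcingAddsNoNewReals
  tfae_finish
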